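/- A \emph{continuum} is a compact connected Hausdorff space with more than one point. The \emph{weight} $w(X)$ of a topological space $X$ is the least cardinality of a base of its topology, and its \emph{size} is the cardinality $|X|$. An infinite space $X$ is \emph{balanced} if $|U| = |X|$ and $w(U) = w(X)$ for every nonempty open subspace $U$ of $X$. Let $\kappa$ be an infinite cardinal. (a) Let $J$ be a pathwise connected continuum with $w(J) \le \kappa$. Then there exist $2^{\kappa}$ mutually non-homeomorphic pathwise connected continua $X_J$ of weight $\kappa$ and size $\max\{\kappa, |J|\}$, such that all the spaces $X_J$ are balanced if $J$ is balanced and $w(J) = \kappa$. (b) Consequently, there exist, up to homeomorphism, precisely $2^{\kappa}$ pathwise connected balanced continua of weight $\kappa$ and size $2^{\kappa}$. -/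

import Mathlib

open Cardinal

universe u

namespace CountingContinua

/-- The weight `w(X)` of a topological space: the least cardinality of a base of its topology. -/
noncomputable def weight (X : Type u) [TopologicalSpace X] : Cardinal.{u} :=
  sInf {c : Cardinal.{u} | ∃ B : Set (Set X), TopologicalSpace.IsTopologicalBasis B ∧ #B = c}

/-- A continuum is a compact connected Hausdorff space with more than one point. -/
structure IsContinuum (X : Type u) [TopologicalSpace X] : Prop where
  compact : CompactSpace X
  hausdorff : T2Space X
  connected : ConnectedSpace X
  nontrivial : Nontrivial X

/-- A pathwise connected continuum of weight `κ` and size `lam`. -/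
structure IsPathContinuum (κ lam : Cardinal.{u}) (X : Type u) [TopologicalSpace X] : Prop where
  continuum : IsContinuum X
  pathConnected : PathConnectedSpace X
  weight_eq : weight X = κ
  size_eq : #X = lam

/-- An infinite space is balanced if each of its nonempty open subspaces has the same size and the
same weight as the whole space. -/
structure Balanced (X : Type u) [TopologicalSpace X] : Prop where
  infinite : Infinite X
  size_eq : ∀ U : Set X, IsOpen U → U.Nonempty → #U = #X
  weight_eq : ∀ U : Set X, IsOpen U → U.Nonempty → weight U = weight X

/-- The members of a family of topological spaces are mutually non-homeomorphic. -/
def MutuallyNonHomeomorphic {I : Type u} (X : I → Type u) [∀ i, TopologicalSpace (X i)] : Prop :=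
  ∀ i j : I, i ≠ j → IsEmpty (X i ≃ₜ X j)

end CountingContinua

/-!
For a space `X` and `x : X`, the space of components of `X \ {x}` is a homeomorphism invariant of
the pair `(X, x)`. Given a totally disconnected compact space `Z` and a path connected continuum `P`
without cut points, the fan of `Z` many copies of `P` glued at a common point has one point whose
removal leaves `Z` as component space; no other point is a cut point. Gluing infinitely many fans
into a compact bouquet adds only a point whose removal leaves a noncompact component space, so the
bouquet determines which spaces `Z` were used. With `P = J × J`, which has no cut points, and `κ`
distinct spaces `Z` of size at most `κ`, namely the ordinal intervals `[0, ω ^ α]`, which are told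
apart by their Cantor–Bendixson derivatives, the subsets of `κ` yield `2 ^ κ` bouquets. Each point
of a bouquet lies in a copy of `J`, so the bouquet is balanced if `J` is and sizes and weights
agree.

Every compact Hausdorff space of weight at most `κ` embeds in the cube `[0, 1] ^ κ`, which has at
most `2 ^ κ` closed subsets; this bounds the number of homeomorphism types from above. The cube is
itself balanced of weight `κ` and size `2 ^ κ`, so it can serve as `J`.
-/

namespace CountingContinua

open TopologicalSpace Set Topology

section Weight

variable {X Y : Type u} [TopologicalSpace X] [TopologicalSpace Y] {κ : Cardinal.{u}}

theorem exists_isTopologicalBasis_mk_eq_weight (X : Type u) [TopologicalSpace X] :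
    ∃ B : Set (Set X), IsTopologicalBasis B ∧ #B = weight X :=
  csInf_mem (s := {c : Cardinal.{u} | ∃ B : Set (Set X), IsTopologicalBasis B ∧ #B = c})
    ⟨_, _, isTopologicalBasis_opens, rfl⟩

theorem weight_le_of_isTopologicalBasis {B : Set (Set X)} (hB : IsTopologicalBasis B) :
    weight X ≤ #B :=
  csInf_le' ⟨B, hB, rfl⟩

theorem weight_le_of_isInducing {f : X → Y} (hf : IsInducing f) : weight X ≤ weight Y := by
  obtain ⟨B, hB, hBc⟩ := exists_isTopologicalBasis_mk_eq_weight Y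
  have hB' : IsTopologicalBasis (preimage f '' B) := by
    rw [hf.eq_induced]
    exact hB.induced f
  exact (weight_le_of_isTopologicalBasis hB').trans (hBc ▸ mk_image_le)

theorem weight_eq_of_homeomorph (h : X ≃ₜ Y) : weight X = weight Y :=
  le_antisymm (weight_le_of_isInducing h.isInducing) (weight_le_of_isInducing h.symm.isInducing)

theorem weight_prod_le : weight (X × Y) ≤ weight X * weight Y := by
  obtain ⟨B, hB, hBc⟩ := exists_isTopologicalBasis_mk_eq_weight X
  obtain ⟨C, hC, hCc⟩ := exists_isTopologicalBasis_mk_eq_weight Y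
  rw [← hBc, ← hCc]
  refine (weight_le_of_isTopologicalBasis (hB.prod hC)).trans ?_
  rw [← image_prod]
  exact mk_image_le.trans (mk_setProd B C).le

theorem weight_sigma_le {ι : Type u} {Y : ι → Type u} [∀ i, TopologicalSpace (Y i)] :
    weight (Σ i, Y i) ≤ sum fun i => weight (Y i) := by
  choose B hB hBc using fun i => exists_isTopologicalBasis_mk_eq_weight (Y i)
  refine (weight_le_of_isTopologicalBasis (IsTopologicalBasis.sigma hB)).trans ?_
  refine mk_iUnion_le_sum_mk.trans (sum_le_sum _ _ fun i => ?_)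
  exact mk_image_le.trans (hBc i).le

theorem weight_le_of_eq_generateFrom {X : Type u} [t : TopologicalSpace X] (hκ : ℵ₀ ≤ κ)
    {S : Set (Set X)} (hS : t = generateFrom S) (hSc : #S ≤ κ) : weight X ≤ κ := by
  refine (weight_le_of_isTopologicalBasis (isTopologicalBasis_of_subbasis hS)).trans ?_
  refine mk_image_le.trans ?_
  let g : Finset S → Set (Set X) := fun F => Subtype.val '' (F : Set S)
  have hsub : {f : Set (Set X) | f.Finite ∧ f ⊆ S} ⊆ range g := by
    rintro f ⟨hf, hfS⟩
    have hfin : (Subtype.val ⁻¹' f : Set S).Finite := hf.preimage Subtype.val_injective.injOn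
    refine ⟨hfin.toFinset, ?_⟩
    simp only [g, Finite.coe_toFinset, Subtype.image_preimage_coe]
    exact inter_eq_right.2 hfS
  refine (mk_le_mk_of_subset hsub).trans (mk_range_le.trans ?_)
  rcases finite_or_infinite S with h | h
  · exact (mk_lt_aleph0 (α := Finset S)).le.trans hκ
  · rw [mk_finset_of_infinite]
    exact hSc

theorem weight_pi_le (hκ : ℵ₀ ≤ κ) {ι : Type u} (hι : #ι ≤ κ) {Y : ι → Type u}
    [∀ i, TopologicalSpace (Y i)] (hY : ∀ i, weight (Y i) ≤ κ) : weight (∀ i, Y i) ≤ κ := by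
  choose B hB hBc using fun i => exists_isTopologicalBasis_mk_eq_weight (Y i)
  refine weight_le_of_eq_generateFrom hκ
    (S := ⋃ i, preimage (Function.eval i) '' B i) ?_ ?_
  · simp only [generateFrom_iUnion, ← induced_generateFrom_eq, ← (hB _).eq_generateFrom]
    rfl
  · refine (mk_iUnion_le _).trans ((mul_le_mul' hι (ciSup_le' fun i => ?_)).trans
      (mul_eq_self hκ).le)
    exact mk_image_le.trans ((hBc i).le.trans (hY i))

theorem weight_le_of_separating {X : Type u} [t : TopologicalSpace X] [CompactSpace X]
    (hκ : ℵ₀ ≤ κ) {S : Set (Set X)} (hSo : ∀ U ∈ S, IsOpen U) (hSc : #S ≤ κ)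
    (hS : ∀ x y : X, x ≠ y → ∃ U ∈ S, ∃ V ∈ S, x ∈ U ∧ y ∈ V ∧ Disjoint U V) :
    weight X ≤ κ := by
  refine weight_le_of_eq_generateFrom hκ (S := S) ?_ hSc
  have hle : t ≤ generateFrom S := le_generateFrom hSo
  have hT2 : @T2Space X (generateFrom S) := by
    refine @T2Space.mk X (generateFrom S) fun x y hxy => ?_
    obtain ⟨U, hU, V, hV, hx, hy, hd⟩ := hS x y hxy
    exact ⟨U, V, isOpen_generateFrom_of_mem hU, isOpen_generateFrom_of_mem hV, hx, hy, hd⟩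
  -- A continuous bijection from a compact space to a Hausdorff space is closed.
  have hclosed : @IsClosedMap X X t (generateFrom S) id :=
    @Continuous.isClosedMap X X t (generateFrom S) _ hT2 id (continuous_id_iff_le.2 hle)
  refine le_antisymm hle fun U hU => ?_
  have hUc := hclosed Uᶜ (@IsOpen.isClosed_compl X t U hU)
  rwa [image_id, @isClosed_compl_iff X (generateFrom S)] at hUc

theorem weight_le_of_mk_le [CompactSpace X] [T2Space X] (hκ : ℵ₀ ≤ κ) (hX : #X ≤ κ) :
    weight X ≤ κ := by
  choose U V hU hV hxU hyV hUV using
    fun p : {p : X × X // p.1 ≠ p.2} => t2_separation p.2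
  have hXX : #{p : X × X // p.1 ≠ p.2} ≤ κ := by
    refine (mk_subtype_le _).trans ?_
    rw [← mul_def]
    exact (mul_le_mul' hX hX).trans (mul_eq_self hκ).le
  refine weight_le_of_separating hκ (S := range U ∪ range V) ?_ ?_ fun x y hxy =>
    ⟨_, Or.inl ⟨⟨(x, y), hxy⟩, rfl⟩, _, Or.inr ⟨⟨(x, y), hxy⟩, rfl⟩, hxU _, hyV _, hUV _⟩
  · rintro _ (⟨p, rfl⟩ | ⟨p, rfl⟩)
    exacts [hU p, hV p]
  · refine (mk_union_le _ _).trans ?_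
    exact (add_le_add (mk_range_le.trans hXX) (mk_range_le.trans hXX)).trans (add_eq_self hκ).le

theorem weight_onePoint_le [T2Space (OnePoint X)] (hκ : ℵ₀ ≤ κ) (hX : weight X ≤ κ) :
    weight (OnePoint X) ≤ κ := by
  obtain ⟨B, hB, hBc⟩ := exists_isTopologicalBasis_mk_eq_weight X
  let coeImage : Set X → Set (OnePoint X) := image (↑)
  let S : Set (Set (OnePoint X)) := coeImage '' B ∪ (fun U => (closure (coeImage U))ᶜ) '' B
  -- Disjoint neighbourhoods of `x` and `y` shrink to a basic set at `x` whose closure misses `y`.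
  have hsep : ∀ (x : X) (y : OnePoint X), (x : OnePoint X) ≠ y →
      ∃ U ∈ S, ∃ V ∈ S, (x : OnePoint X) ∈ U ∧ y ∈ V ∧ Disjoint U V := by
    intro x y hxy
    obtain ⟨U, V, hU, hV, hxU, hyV, hUV⟩ := t2_separation hxy
    obtain ⟨W, hW, hxW, hWU⟩ :=
      hB.exists_subset_of_mem_open hxU (hU.preimage OnePoint.continuous_coe)
    have hWV : closure (coeImage W) ⊆ Vᶜ :=
      closure_minimal (image_subset_iff.2 fun z hz => disjoint_left.1 hUV (hWU hz))
        hV.isClosed_compl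
    exact ⟨_, Or.inl ⟨W, hW, rfl⟩, _, Or.inr ⟨W, hW, rfl⟩, ⟨x, hxW, rfl⟩, fun h => hWV h hyV,
      disjoint_compl_right.mono_left subset_closure⟩
  refine weight_le_of_separating hκ (S := S) ?_ ?_ fun x y hxy => ?_
  · rintro _ (⟨U, hU, rfl⟩ | ⟨U, -, rfl⟩)
    · exact OnePoint.isOpenEmbedding_coe.isOpenMap U (hB.isOpen hU)
    · exact isClosed_closure.isOpen_compl
  · refine (mk_union_le _ _).trans ((add_le_add mk_image_le mk_image_le).trans ?_)
    rw [hBc]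
    exact (add_le_add hX hX).trans (add_eq_self hκ).le
  · induction x using OnePoint.rec with
    | coe x => exact hsep x y hxy
    | infty =>
      obtain ⟨z, rfl⟩ := OnePoint.ne_infty_iff_exists.1 hxy.symm
      obtain ⟨U, hU, V, hV, hzU, hV', hUV⟩ := hsep z _ hxy.symm
      exact ⟨V, hV, U, hU, hV', hzU, hUV.symm⟩

theorem mk_le_weight {ι : Type u} (x : ι → X) (U : ι → Set X) (hU : ∀ i, IsOpen (U i))
    (hmem : ∀ i j, x j ∈ U i ↔ i = j) : #ι ≤ weight X := by
  obtain ⟨B, hB, hBc⟩ := exists_isTopologicalBasis_mk_eq_weight X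
  choose b hbB hxb hbU using
    fun i => hB.exists_subset_of_mem_open ((hmem i i).2 rfl) (hU i)
  rw [← hBc]
  refine mk_le_of_injective (f := fun i => (⟨b i, hbB i⟩ : B)) fun i j hij => ?_
  have hb : b i = b j := congrArg Subtype.val hij
  exact (hmem i j).1 (hbU i (hb ▸ hxb j))

theorem IsContinuum.infinite (h : IsContinuum X) : Infinite X := by
  have := h.hausdorff
  have := h.connected
  have := h.nontrivial
  exact infinite_univ_iff.1 (isPreconnected_univ.infinite_of_nontrivial nontrivial_univ)

theorem IsContinuum.weight_le_mk (h : IsContinuum X) : weight X ≤ #X := by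
  have := h.compact
  have := h.hausdorff
  have := h.infinite
  exact weight_le_of_mk_le (aleph0_le_mk X) le_rfl

end Weight

namespace Balanced

variable {X Y : Type u} [TopologicalSpace X] [TopologicalSpace Y]

theorem of_le [Infinite X]
    (h : ∀ U : Set X, IsOpen U → U.Nonempty → #X ≤ #U ∧ weight X ≤ weight U) : Balanced X where
  infinite := ‹_›
  size_eq U hU hne := le_antisymm (mk_set_le U) (h U hU hne).1
  weight_eq U hU hne :=
    le_antisymm (weight_le_of_isInducing IsInducing.subtypeVal) (h U hU hne).2

theorem of_forall_mem_range (hX : Balanced X) (hc : #Y = #X) (hw : weight Y = weight X)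
    (h : ∀ y : Y, ∃ f : X → Y, IsEmbedding f ∧ y ∈ range f) : Balanced Y := by
  have := hX.infinite
  have : Infinite Y := infinite_iff.2 (hc ▸ aleph0_le_mk X)
  refine of_le fun U hU ⟨y, hy⟩ => ?_
  obtain ⟨f, hf, x, rfl⟩ := h y
  have hV : IsOpen (f ⁻¹' U) := hU.preimage hf.continuous
  rw [hc, hw, ← hX.size_eq _ hV ⟨x, hy⟩, ← hX.weight_eq _ hV ⟨x, hy⟩]
  exact ⟨mk_le_of_injective (hf.injective.restrictPreimage U),
    weight_le_of_isInducing (hf.restrictPreimage U).isInducing⟩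

theorem of_forall_range_subset [Infinite X]
    (h : ∀ U : Set X, IsOpen U → U.Nonempty → ∃ f : X → X, IsEmbedding f ∧ range f ⊆ U) :
    Balanced X := by
  refine of_le fun U hU hne => ?_
  obtain ⟨f, hf, hfU⟩ := h U hU hne
  have hmaps : ∀ x, f x ∈ U := fun x => hfU (mem_range_self x)
  exact ⟨mk_le_of_injective (hf.injective.codRestrict hmaps),
    weight_le_of_isInducing (hf.codRestrict U hmaps).isInducing⟩

end Balanced

section CantorBendixson

universe v w w'

/-- The `o`-th Cantor–Bendixson derivative of a space, by transfinite recursion: the points at which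
every earlier derivative accumulates. It distinguishes the compact ordinals `ω ^ a + 1`. -/
def cbDerivative (X : Type w) [TopologicalSpace X] (o : Ordinal.{v}) : Set X :=
  {x | ∀ b, ∀ _ : b < o, AccPt x (Filter.principal (cbDerivative X b))}
termination_by o

theorem mem_cbDerivative {X : Type w} [TopologicalSpace X] {o : Ordinal.{v}} {x : X} :
    x ∈ cbDerivative X o ↔ ∀ b < o, AccPt x (Filter.principal (cbDerivative X b)) := by
  rw [cbDerivative, mem_ofPred_eq]

theorem preimage_cbDerivative {X : Type w} {Y : Type w'} [TopologicalSpace X] [TopologicalSpace Y]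
    {f : X → Y} (hf : IsOpenEmbedding f) (o : Ordinal.{v}) :
    f ⁻¹' cbDerivative Y o = cbDerivative X o := by
  induction o using WellFoundedLT.induction with
  | ind o ih =>
    ext x
    rw [mem_preimage, mem_cbDerivative, mem_cbDerivative]
    refine forall₂_congr fun b hb => ?_
    rw [← ih b hb, ← Filter.comap_principal, hf.accPt_comap_iff]

open Ordinal

theorem exists_dvd_between_iff_mul_omega0_dvd {b x : Ordinal.{v}} (hb : b ≠ 0) :
    (∀ y < x, ∃ z, b ∣ z ∧ y < z ∧ z < x) ↔ b * ω ∣ x := by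
  have hb' : 0 < b := pos_iff_ne_zero.2 hb
  constructor
  · intro h
    have hsucc : ∀ q, b * q < x → b * Order.succ q < x := by
      intro q hq
      obtain ⟨_, ⟨m, rfl⟩, hqm, hmx⟩ := h _ hq
      rw [mul_lt_mul_iff_right₀ hb'] at hqm
      exact (mul_le_mul_right (Order.succ_le_of_lt hqm) _).trans_lt hmx
    obtain ⟨m, rfl⟩ : b ∣ x := by
      refine ⟨x / b, ((mul_div_le x _).antisymm (le_of_not_gt fun hlt => ?_)).symm⟩
      exact (hsucc _ hlt).not_ge (lt_mul_succ_div x hb).le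
    refine mul_dvd_mul_left _ (isSuccPrelimit_iff_omega0_dvd.1 ?_)
    refine Order.isSuccPrelimit_of_succ_lt fun q hq => ?_
    exact (mul_lt_mul_iff_right₀ hb').1 (hsucc q ((mul_lt_mul_iff_right₀ hb').2 hq))
  · rintro ⟨m, rfl⟩ y hy
    rw [mul_assoc] at hy ⊢
    have hm : m ≠ 0 := by
      rintro rfl
      simp at hy
    have hlim : Order.IsSuccLimit (ω * m) :=
      isSuccLimit_mul_left isSuccLimit_omega0 (pos_iff_ne_zero.2 hm)
    exact ⟨b * Order.succ (y / b), dvd_mul_right _ _, lt_mul_succ_div y hb,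
      (mul_lt_mul_iff_right₀ hb').2 (hlim.succ_lt ((lt_mul_iff_div_lt hb).1 hy))⟩

theorem accPt_iff_mul_omega0_dvd {b x : Ordinal.{v}} {s : Set Ordinal.{v}} (hb : b ≠ 0)
    (hx : x ≠ 0) (hs : ∀ y ≠ 0, y ∈ s ↔ b ∣ y) :
    AccPt x (Filter.principal s) ↔ b * ω ∣ x := by
  rw [SuccOrder.accPt_principal, ← exists_dvd_between_iff_mul_omega0_dvd hb,
    and_iff_right (fun h => hx h.eq_bot)]
  refine forall₂_congr fun y _ => exists_congr fun z => and_congr_left fun hz => hs z ?_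
  exact (bot_le.trans_lt hz.1).ne'

theorem opow_dvd_iff_forall_lt {a x : Ordinal.{v}} :
    ω ^ a ∣ x ↔ ∀ c < a, ω ^ (c + 1) ∣ x := by
  refine ⟨fun h c hc => (opow_dvd_opow _ (Order.add_one_le_of_lt hc)).trans h, fun h => ?_⟩
  refine dvd_of_mod_eq_zero ?_
  by_contra hr
  have hlog : log ω (x % ω ^ a) < a :=
    (lt_opow_iff_log_lt one_lt_omega0 hr).1 (mod_lt x (opow_ne_zero _ omega0_ne_zero))
  have hdvd : ω ^ (log ω (x % ω ^ a) + 1) ∣ x % ω ^ a := by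
    rw [← Ordinal.dvd_add_iff (b := ω ^ a * (x / ω ^ a)) ((opow_dvd_opow _
      (Order.add_one_le_of_lt hlog)).trans (dvd_mul_right _ _)), div_add_mod]
    exact h _ hlog
  exact (le_of_dvd hr hdvd).not_gt (lt_opow_succ_log_self one_lt_omega0 _)

theorem mem_cbDerivative_ordinal_iff {a x : Ordinal.{v}} (hx : x ≠ 0) :
    x ∈ cbDerivative Ordinal.{v} a ↔ ω ^ a ∣ x := by
  induction a using WellFoundedLT.induction generalizing x with
  | ind a ih =>
    rw [mem_cbDerivative, opow_dvd_iff_forall_lt]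
    refine forall₂_congr fun c hc => ?_
    rw [opow_add, opow_one,
      accPt_iff_mul_omega0_dvd (opow_ne_zero _ omega0_ne_zero) hx fun y hy => ih c hc hy]

theorem isOpen_Iic_ordinal (a : Ordinal.{v}) : IsOpen (Iic a) := by
  rw [← Order.Iio_succ]
  exact isOpen_Iio

theorem cbDerivative_Iic_opow_nonempty_iff {a b : Ordinal.{v}} :
    (cbDerivative (Iic (ω ^ a)) b).Nonempty ↔ b ≤ a := by
  have hmem : ∀ x : Iic (ω ^ a), x ∈ cbDerivative (Iic (ω ^ a)) b ↔
      (x : Ordinal) ∈ cbDerivative Ordinal.{v} b := fun x => by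
    rw [← preimage_cbDerivative (isOpen_Iic_ordinal _).isOpenEmbedding_subtypeVal, mem_preimage]
  constructor
  · rintro ⟨x, hx⟩
    rw [hmem] at hx
    by_contra! hab
    have hx0 : (x : Ordinal) ≠ 0 := fun h =>
      (SuccOrder.accPt_principal.1 (mem_cbDerivative.1 hx a hab)).1 (h ▸ isMin_bot)
    exact (le_of_dvd hx0 ((mem_cbDerivative_ordinal_iff hx0).1 hx)).not_gt
      (x.2.trans_lt ((opow_lt_opow_iff_right one_lt_omega0).2 hab))
  · intro hba
    exact ⟨⟨ω ^ a, self_mem_Iic⟩, (hmem _).2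
      ((mem_cbDerivative_ordinal_iff (opow_ne_zero _ omega0_ne_zero)).2 (opow_dvd_opow _ hba))⟩

theorem eq_of_homeomorph_Iic_opow {a b : Ordinal.{v}} (h : Iic (ω ^ a) ≃ₜ Iic (ω ^ b)) :
    a = b := by
  refine eq_of_forall_le_iff fun c => ?_
  rw [← cbDerivative_Iic_opow_nonempty_iff, ← cbDerivative_Iic_opow_nonempty_iff,
    ← preimage_cbDerivative h.isOpenEmbedding, h.surjective.nonempty_preimage]

instance totallyDisconnectedSpace_ordinal : TotallyDisconnectedSpace Ordinal.{v} := by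
  suffices TotallySeparatedSpace Ordinal.{v} from inferInstance
  refine totallySeparatedSpace_iff_exists_isClopen.2 fun x y hxy => ?_
  rcases lt_or_gt_of_ne hxy with h | h
  · exact ⟨Iic x, ⟨isClosed_Iic, isOpen_Iic_ordinal x⟩, self_mem_Iic, h.not_ge⟩
  · refine ⟨Ioi y, ⟨?_, isOpen_Ioi⟩, h, lt_irrefl y⟩
    rw [← compl_Iic]
    exact (isOpen_Iic_ordinal y).isClosed_compl

theorem mk_shrink_Iic_ordinal (a : Ordinal.{u}) : #(Shrink.{u} (Iic a)) = a.card + 1 := by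
  rw [← Cardinal.lift_inj.{u, u + 1}, Cardinal.lift_mk_shrink'', ← Order.Iio_succ,
    Cardinal.mk_Iio_ordinal, Order.succ_eq_add_one, card_add_one]

theorem exists_nonhomeomorphic_totallyDisconnected {κ : Cardinal.{u}} (hκ : ℵ₀ ≤ κ) {ι : Type u}
    (hι : #ι ≤ κ) :
    ∃ (Z : ι → Type u) (_ : ∀ i, TopologicalSpace (Z i)),
      (∀ i, CompactSpace (Z i) ∧ T2Space (Z i) ∧ TotallyDisconnectedSpace (Z i) ∧
        Nontrivial (Z i) ∧ #(Z i) ≤ κ) ∧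
      ∀ i j, Nonempty (Z i ≃ₜ Z j) → i = j := by
  let r : ι → ι → Prop := WellOrderingRel
  let e : ι → Ordinal.{u} := fun i => typein r i
  have hcard : ∀ i, (e i).card ≤ κ := fun i =>
    ((card_le_card (typein_lt_type r i).le).trans_eq (card_type r)).trans hι
  have hopow : ∀ i, (ω ^ e i).card ≤ κ := fun i =>
    (card_opow_le _ _).trans (max_le hκ (max_le (by simpa using hκ) (hcard i)))
  refine ⟨fun i => Shrink.{u} (Iic (ω ^ e i)), fun i => inferInstance, fun i => ?_, ?_⟩
  · let h := Shrink.homeomorph.{u} (Iic (ω ^ e i))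
    have : CompactSpace (Iic (ω ^ e i)) := by
      rw [← isCompact_iff_compactSpace, ← Icc_bot]
      exact isCompact_Icc
    have : Nontrivial (Iic (ω ^ e i)) :=
      ⟨⟨0, mem_Iic.2 bot_le⟩, ⟨ω ^ e i, self_mem_Iic⟩, fun h =>
        opow_ne_zero (e i) omega0_ne_zero (congrArg Subtype.val h).symm⟩
    refine ⟨h.compactSpace, h.t2Space, h.totallyDisconnectedSpace, h.toEquiv.symm.nontrivial, ?_⟩
    rw [mk_shrink_Iic_ordinal]
    exact (add_le_add (hopow i) (one_le_aleph0.trans hκ)).trans (add_eq_self hκ).le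
  · rintro i j ⟨h⟩
    exact typein_injective r (eq_of_homeomorph_Iic_opow
      ((Shrink.homeomorph _).trans (h.trans (Shrink.homeomorph _).symm)))

end CantorBendixson

section Product

variable {X Y : Type*} [TopologicalSpace X] [TopologicalSpace Y] [PreconnectedSpace X]
  [PreconnectedSpace Y]

theorem isPreconnected_cross (x : X) (y : Y) :
    IsPreconnected ({x} ×ˢ Set.univ ∪ Set.univ ×ˢ {y} : Set (X × Y)) :=
  (isPreconnected_singleton.prod isPreconnected_univ).union (x, y) ⟨rfl, trivial⟩ ⟨trivial, rfl⟩
    (isPreconnected_univ.prod isPreconnected_singleton)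

theorem isConnected_compl_singleton_prod [Nontrivial X] [Nontrivial Y] (p : X × Y) :
    IsConnected ({p}ᶜ : Set (X × Y)) := by
  obtain ⟨a, b⟩ := p
  obtain ⟨x, hx⟩ := exists_ne a
  obtain ⟨y, hy⟩ := exists_ne b
  have hcross : ∀ c d, c ≠ a → d ≠ b →
      ({c} ×ˢ Set.univ ∪ Set.univ ×ˢ {d} : Set (X × Y)) ⊆ {(a, b)}ᶜ := by
    rintro c d hc hd _ h rfl
    exact h.elim (fun h => hc h.1.symm) fun h => hd h.2.symm
  refine ⟨⟨(x, y), fun h => hx (congrArg Prod.fst h)⟩, isPreconnected_of_forall (x, y) ?_⟩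
  rintro ⟨c, d⟩ hcd
  by_cases hc : c = a
  · have hd : d ≠ b := fun hd => hcd (Prod.ext hc hd)
    exact ⟨_, hcross x d hx hd, .inl ⟨rfl, trivial⟩, .inr ⟨trivial, rfl⟩, isPreconnected_cross x d⟩
  · exact ⟨_, hcross c y hc hy, .inr ⟨trivial, rfl⟩, .inl ⟨rfl, trivial⟩, isPreconnected_cross c y⟩

end Product

section ComplComponents

variable {X Y : Type*} [TopologicalSpace X] [TopologicalSpace Y]

/-- The space of components of the complement of the point `x`. The homeomorphism types of these
spaces, as `x` varies, are the invariant that tells the continua constructed below apart. -/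
abbrev ComplComponents (x : X) : Type _ :=
  ConnectedComponents ↥({x}ᶜ : Set X)

theorem nonempty_homeomorph_connectedComponents (h : X ≃ₜ Y) :
    Nonempty (ConnectedComponents X ≃ₜ ConnectedComponents Y) :=
  ⟨h.isQuotientMap.isCoinducing.connectedComponentsHomeomorph fun y => by
    rw [← h.image_symm, image_singleton]
    exact isConnected_singleton⟩

theorem nonempty_homeomorph_complComponents (h : X ≃ₜ Y) (x : X) :
    Nonempty (ComplComponents x ≃ₜ ComplComponents (h x)) :=
  nonempty_homeomorph_connectedComponents (h.sets (by ext; simp))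

theorem nonempty_connectedComponents_homeomorph_self [TotallyDisconnectedSpace X] :
    Nonempty (ConnectedComponents X ≃ₜ X) :=
  ⟨{ toFun := continuous_id.connectedComponentsLift
     invFun := ConnectedComponents.mk
     left_inv := fun c => by
       obtain ⟨x, rfl⟩ := ConnectedComponents.surjective_coe c
       rw [continuous_id.connectedComponentsLift_apply_coe, id]
     right_inv := continuous_id.connectedComponentsLift_apply_coe
     continuous_toFun := continuous_id.connectedComponentsLift_continuous
     continuous_invFun := ConnectedComponents.continuous_coe }⟩

theorem not_compactSpace_connectedComponents {ι : Type*} [TopologicalSpace ι] [DiscreteTopology ι]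
    [Infinite ι] {f : X → ι} (hf : Continuous f) (hsurj : Function.Surjective f) :
    ¬ CompactSpace (ConnectedComponents X) := by
  intro _
  have hlift : Function.Surjective hf.connectedComponentsLift := fun i => by
    obtain ⟨x, rfl⟩ := hsurj i
    exact ⟨x, hf.connectedComponentsLift_apply_coe x⟩
  have := hlift.compactSpace hf.connectedComponentsLift_continuous
  exact not_finite_iff_infinite.2 ‹_› (finite_of_compact_of_discrete (X := ι))

end ComplComponents

/-- The space obtained from `X` by collapsing the closed set `F` to a point and compactifying at
that point. For compact `X` it is the quotient `X / F`; for a disjoint union of compact pointed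
spaces and `F` the set of base points, it is their compact bouquet. -/
abbrev Collapse {X : Type*} [TopologicalSpace X] (F : Closeds X) : Type _ :=
  OnePoint ↥((F : Set X)ᶜ)

namespace Collapse

variable {X : Type*} [TopologicalSpace X] {F : Closeds X}

open OnePoint Classical in
/-- The collapsing map, which sends the points of `F` to `∞` and is the identity elsewhere. -/
noncomputable def mk (F : Closeds X) (x : X) : Collapse F :=
  if h : x ∈ F then ∞ else ((⟨x, h⟩ : ↥((F : Set X)ᶜ)) : Collapse F)

open OnePoint

theorem nonempty_homeomorph_complComponents_infty :
    Nonempty (ComplComponents (∞ : Collapse F) ≃ₜ ConnectedComponents ↥((F : Set X)ᶜ)) :=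
  nonempty_homeomorph_connectedComponents
    ((Homeomorph.setCongr compl_infty).trans isOpenEmbedding_coe.isEmbedding.toHomeomorph.symm)

theorem mk_of_mem {x : X} (h : x ∈ F) : mk F x = ∞ :=
  dif_pos h

theorem mk_of_notMem {x : X} (h : x ∉ F) : mk F x = ((⟨x, h⟩ : ↥((F : Set X)ᶜ)) : Collapse F) :=
  dif_neg h

theorem mk_coe (x : ↥((F : Set X)ᶜ)) : mk F x = (x : Collapse F) :=
  mk_of_notMem x.2

theorem mk_eq_infty_iff {x : X} : mk F x = ∞ ↔ x ∈ F := by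
  refine ⟨fun hx => ?_, mk_of_mem⟩
  by_contra h
  exact coe_ne_infty _ ((mk_of_notMem h).symm.trans hx)

theorem mk_eq_mk_iff {x y : X} (hx : x ∉ F) : mk F x = mk F y ↔ x = y := by
  refine ⟨fun h => ?_, congrArg _⟩
  have hy : y ∉ F := fun hy => hx (mk_eq_infty_iff.1 (h.trans (mk_of_mem hy)))
  rw [mk_of_notMem hx, mk_of_notMem hy] at h
  exact congrArg Subtype.val (coe_injective h)

theorem mk_surjective (hF : (F : Set X).Nonempty) : Function.Surjective (mk F) := by
  intro p
  induction p using OnePoint.rec with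
  | infty => exact hF.imp fun x hx => mk_of_mem hx
  | coe x => exact ⟨x, mk_coe x⟩

theorem continuous_mk [T2Space X] : Continuous (mk F) := by
  refine continuous_def.2 fun U hU => ?_
  have hsub : ∀ V : Set (Collapse F), ∞ ∉ V →
      mk F ⁻¹' V = (↑) '' ((↑) ⁻¹' V : Set ↥((F : Set X)ᶜ)) := by
    intro V hV
    ext x
    by_cases hx : x ∈ F
    · simp [mk_of_mem hx, hV, hx]
    · simp [mk_of_notMem hx, hx]
  by_cases h : ∞ ∈ U
  · rw [← isClosed_compl_iff, ← preimage_compl, hsub Uᶜ (not_not_intro h), preimage_compl]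
    exact (((isOpen_iff_of_mem h).1 hU).2.image continuous_subtype_val).isClosed
  · rw [hsub U h]
    exact F.isClosed.isOpen_compl.isOpenMap_subtype_val _ ((isOpen_iff_of_notMem h).1 hU)

instance [LocallyCompactSpace X] : LocallyCompactSpace ↥((F : Set X)ᶜ) :=
  F.isClosed.isOpen_compl.locallyCompactSpace

/-- The map out of `Collapse F` given by `g` off `F`, with value `t` at the collapsed point. -/
def lift {T : Type*} (g : X → T) (t : T) (p : Collapse F) : T :=
  p.elim t fun x => g x

section Lift

variable {T : Type*} {g : X → T} {t : T}

theorem lift_mk (hg : ∀ x ∈ F, g x = t) (x : X) : lift g t (mk F x) = g x := by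
  by_cases hx : x ∈ F
  · rw [mk_of_mem hx, hg x hx]
    rfl
  · rw [mk_of_notMem hx]
    rfl

theorem continuous_lift [TopologicalSpace T] (hg : Continuous g) (hgF : ∀ x ∈ F, g x = t)
    (hgt : Filter.Tendsto g (Filter.cocompact X) (𝓝 t)) : Continuous (lift (F := F) g t) := by
  refine (OnePoint.continuous_iff _).2 ⟨?_, hg.comp continuous_subtype_val⟩
  refine Filter.hasBasis_coclosedCompact.tendsto_left_iff.2 fun N hN => ?_
  obtain ⟨O, hON, hO, htO⟩ := mem_nhds_iff.1 hN
  obtain ⟨K, hK, hKO⟩ := Filter.mem_cocompact.1 (hgt (hO.mem_nhds htO))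
  have hclosed : IsClosed (g ⁻¹' Oᶜ) := hO.isClosed_compl.preimage hg
  have hcompact : IsCompact (g ⁻¹' Oᶜ) :=
    hK.of_isClosed_subset hclosed fun x hx => by_contra fun hxK => hx (hKO hxK)
  have hdisj : g ⁻¹' Oᶜ ⊆ (F : Set X)ᶜ := fun x hx hxF => hx ((hgF x hxF).symm ▸ htO)
  refine ⟨(↑) ⁻¹' (g ⁻¹' Oᶜ), ⟨hclosed.preimage continuous_subtype_val, ?_⟩, fun x hx => ?_⟩
  · rwa [Subtype.isCompact_iff, Subtype.image_preimage_coe, inter_eq_right.2 hdisj]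
  · exact hON (not_not.1 hx)

end Lift

theorem pathConnectedSpace (hF : (F : Set X).Nonempty) [T2Space X]
    (h : ∀ x, ∃ y ∈ F, Joined x y) : PathConnectedSpace (Collapse F) := by
  have hinfty : ∀ p : Collapse F, Joined p ∞ := fun p => by
    obtain ⟨x, rfl⟩ := mk_surjective hF p
    obtain ⟨y, hy, hxy⟩ := h x
    rw [← mk_of_mem hy]
    exact hxy.map continuous_mk
  exact ⟨⟨∞⟩, fun p q => (hinfty p).trans (hinfty q).symm⟩

theorem isPreconnected_of_preimage [T2Space X] {S : Set (Collapse F)} (hS : ∞ ∈ S)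
    (h : ∀ x, mk F x ∈ S → ∃ C, IsPreconnected C ∧ x ∈ C ∧ MapsTo (mk F) C S ∧
      (C ∩ F).Nonempty) :
    IsPreconnected S := by
  refine isPreconnected_of_forall ∞ fun p hp => ?_
  induction p using OnePoint.rec with
  | infty => exact ⟨{∞}, by simpa using hS, rfl, rfl, isPreconnected_singleton⟩
  | coe x =>
    rw [← mk_coe] at hp ⊢
    obtain ⟨C, hC, hx, hCS, y, hyC, hyF⟩ := h x hp
    exact ⟨mk F '' C, hCS.image_subset, ⟨y, hyC, mk_of_mem hyF⟩, mem_image_of_mem _ hx,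
      hC.image _ continuous_mk.continuousOn⟩

end Collapse

/-- `Z` copies of the space `P`, glued together at the point `p` of `P`. -/
abbrev Fan (Z : Type*) {P : Type*} [TopologicalSpace Z] [TopologicalSpace P] [T1Space P] (p : P) :
    Type _ :=
  Collapse (⟨Prod.snd ⁻¹' {p}, isClosed_singleton.preimage continuous_snd⟩ : Closeds (Z × P))

namespace Fan

variable {Z P : Type*} [TopologicalSpace Z] [TopologicalSpace P] {p q : P}

open OnePoint

/-- The point `a` of the `w`-th copy of `P` in the fan. -/
noncomputable def mk [T1Space P] (p : P) (w : Z) (a : P) : Fan Z p :=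
  Collapse.mk _ (w, a)

theorem mk_eq_infty_iff [T1Space P] {w : Z} {a : P} : mk p w a = ∞ ↔ a = p :=
  Collapse.mk_eq_infty_iff

theorem mk_injective [T1Space P] (w : Z) : Function.Injective (mk p w) := by
  intro a b h
  by_cases ha : a = p
  · exact ha.trans (mk_eq_infty_iff.1 (h ▸ mk_eq_infty_iff.2 ha)).symm
  · exact congrArg Prod.snd ((Collapse.mk_eq_mk_iff ha).1 h)

theorem exists_mk_eq [T1Space P] [Nonempty Z] (x : Fan Z p) : ∃ w a, mk p w a = x := by
  obtain ⟨⟨w, a⟩, h⟩ := Collapse.mk_surjective ⟨(Classical.arbitrary Z, p), rfl⟩ x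
  exact ⟨w, a, h⟩

theorem nonempty_homeomorph_complComponents_infty [T1Space P] [TotallyDisconnectedSpace Z]
    (hp : IsConnected ({p}ᶜ : Set P)) :
    Nonempty (ComplComponents (∞ : Fan Z p) ≃ₜ Z) := by
  have := isConnected_iff_connectedSpace.1 hp
  obtain ⟨q, hq⟩ := hp.nonempty
  let petal : Z → ↥({p}ᶜ : Set P) → ↥((Prod.snd ⁻¹' {p} : Set (Z × P))ᶜ) :=
    fun w a => ⟨(w, a), a.2⟩
  have hfst : IsQuotientMap fun y : ↥((Prod.snd ⁻¹' {p} : Set (Z × P))ᶜ) => y.1.1 :=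
    .of_inverse (f := fun w => petal w ⟨q, hq⟩) (by fun_prop) (by fun_prop) fun _ => rfl
  obtain ⟨h₁⟩ := Collapse.nonempty_homeomorph_complComponents_infty
    (F := ⟨Prod.snd ⁻¹' {p}, isClosed_singleton.preimage (continuous_snd (X := Z))⟩)
  obtain ⟨h₂⟩ := nonempty_connectedComponents_homeomorph_self (X := Z)
  refine ⟨h₁.trans ((hfst.isCoinducing.connectedComponentsHomeomorph fun w => ?_).trans h₂)⟩
  have hfiber : (fun y : ↥((Prod.snd ⁻¹' {p} : Set (Z × P))ᶜ) => y.1.1) ⁻¹' {w} =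
      range (petal w) := by
    ext ⟨⟨w', a⟩, ha⟩
    constructor
    · rintro rfl
      exact ⟨⟨a, ha⟩, rfl⟩
    · rintro ⟨b, hb⟩
      exact congrArg (fun y => y.1.1) hb.symm
  rw [hfiber]
  exact isConnected_range (by fun_prop)

instance [T1Space P] [Nonempty Z] [Nontrivial P] : Nontrivial (Fan Z p) :=
  (mk_injective (Classical.arbitrary Z)).nontrivial

variable [T2Space Z] [T2Space P]

theorem continuous_mk (w : Z) : Continuous (mk p w) :=
  Collapse.continuous_mk.comp (by fun_prop)

instance pathConnectedSpace [Nonempty Z] [PathConnectedSpace P] : PathConnectedSpace (Fan Z p) :=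
  Collapse.pathConnectedSpace ⟨(Classical.arbitrary Z, p), rfl⟩ fun x =>
    ⟨(x.1, p), rfl, (PathConnectedSpace.joined x.2 p).map (f := Prod.mk x.1) (by fun_prop)⟩

theorem isPreconnected_compl_singleton_mk [PreconnectedSpace P] {a : P}
    (ha : IsPreconnected ({a}ᶜ : Set P)) (hap : a ≠ p) (w : Z) :
    IsPreconnected ({mk p w a}ᶜ : Set (Fan Z p)) := by
  refine Collapse.isPreconnected_of_preimage (fun h => hap (mk_eq_infty_iff.1 h.symm)) ?_
  rintro ⟨w', a'⟩ h
  by_cases hw : w' = w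
  · subst hw
    refine ⟨{w'} ×ˢ {a}ᶜ, isPreconnected_singleton.prod ha, ⟨rfl, ?_⟩, ?_,
      (w', p), ⟨rfl, hap.symm⟩, rfl⟩
    · rintro rfl
      exact h rfl
    · rintro ⟨_, b⟩ ⟨rfl, hb⟩ hba
      exact hb (mk_injective _ hba)
  · refine ⟨{w'} ×ˢ Set.univ, isPreconnected_singleton.prod isPreconnected_univ, ⟨rfl, trivial⟩, ?_,
      (w', p), ⟨rfl, trivial⟩, rfl⟩
    rintro ⟨_, b⟩ ⟨rfl, -⟩ hba
    exact hw (congrArg Prod.fst ((Collapse.mk_eq_mk_iff hap).1 hba.symm)).symm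

end Fan

section Bouquet

variable {ι : Type*} {Y : ι → Type*} [∀ i, TopologicalSpace (Y i)]

theorem locallyCompactSpace_sigma [∀ i, LocallyCompactSpace (Y i)] :
    LocallyCompactSpace (Σ i, Y i) where
  local_compact_nhds := by
    rintro ⟨i, y⟩ n hn
    rw [Sigma.nhds_mk] at hn
    obtain ⟨s, hs, hsn, hsc⟩ := local_compact_nhds hn
    refine ⟨Sigma.mk i '' s, ?_, image_subset_iff.2 hsn, hsc.image continuous_sigmaMk⟩
    rw [Sigma.nhds_mk]
    exact Filter.image_mem_map hs

/-- The base points of a disjoint union of pointed spaces. -/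
def basePoints [∀ i, T1Space (Y i)] (e : ∀ i, Y i) : Closeds (Σ i, Y i) where
  carrier := {w | w.2 = e w.1}
  isClosed' := isClosed_sigma_iff.2 fun i => isClosed_singleton (x := e i)

/-- The compact bouquet of the pointed spaces `(Y i, e i)`: every neighbourhood of the common base
point contains all but finitely many of the spaces when these are compact. -/
abbrev Bouquet [∀ i, T1Space (Y i)] (e : ∀ i, Y i) : Type _ :=
  Collapse (basePoints e)

namespace Bouquet

open OnePoint

section T1

variable [∀ i, T1Space (Y i)] {e : ∀ i, Y i}

/-- The inclusion of the `i`-th petal. -/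
noncomputable def incl (e : ∀ i, Y i) (i : ι) (y : Y i) : Bouquet e :=
  Collapse.mk _ ⟨i, y⟩

theorem incl_eq_infty_iff {i : ι} {y : Y i} : incl e i y = ∞ ↔ y = e i :=
  Collapse.mk_eq_infty_iff

theorem exists_incl_eq [Nonempty ι] (x : Bouquet e) : ∃ i y, incl e i y = x := by
  obtain ⟨⟨i, y⟩, h⟩ := Collapse.mk_surjective ⟨⟨Classical.arbitrary ι, e _⟩, rfl⟩ x
  exact ⟨i, y, h⟩

open Classical in
/-- The retraction onto the `i`-th petal, which sends all the other petals to its base point. -/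
noncomputable def proj (e : ∀ i, Y i) (i : ι) : Bouquet e → Y i :=
  Collapse.lift (fun w => Function.update e w.1 w.2 i) (e i)

open Classical in
theorem proj_incl (i j : ι) (y : Y j) : proj e i (incl e j y) = Function.update e j y i := by
  refine Collapse.lift_mk (fun w hw => ?_) _
  rw [show w.2 = e w.1 from hw, Function.update_eq_self]

theorem proj_incl_self (i : ι) (y : Y i) : proj e i (incl e i y) = y := by
  classical
  rw [proj_incl, Function.update_self]

theorem proj_incl_of_ne {i j : ι} (h : i ≠ j) (y : Y j) : proj e i (incl e j y) = e i := by
  classical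
  rw [proj_incl, Function.update_of_ne h]

theorem incl_injective (i : ι) : Function.Injective (incl e i) :=
  Function.LeftInverse.injective (g := proj e i) (proj_incl_self i)

theorem incl_proj {i : ι} {x : Bouquet e} (h : proj e i x ≠ e i) : incl e i (proj e i x) = x := by
  have : Nonempty ι := ⟨i⟩
  obtain ⟨j, y, rfl⟩ := exists_incl_eq x
  by_cases hij : i = j
  · subst hij
    rw [proj_incl_self]
  · exact absurd (proj_incl_of_ne hij y) h

theorem continuous_proj [∀ i, CompactSpace (Y i)] (i : ι) : Continuous (proj e i) := by
  classical
  refine Collapse.continuous_lift (continuous_sigma fun j => ?_) (fun w hw => ?_) ?_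
  · by_cases hij : i = j
    · subst hij
      simpa only [Function.update_self] using continuous_id'
    · simpa only [Function.update_of_ne hij] using continuous_const
  · rw [show w.2 = e w.1 from hw, Function.update_eq_self]
  · refine tendsto_nhds_of_eventually_eq (Filter.mem_cocompact.2
      ⟨Sigma.mk i '' univ, isCompact_univ.image continuous_sigmaMk, ?_⟩)
    rintro ⟨j, y⟩ hw
    refine Function.update_of_ne ?_ _ _
    rintro rfl
    exact hw ⟨y, trivial, rfl⟩

theorem not_compactSpace_complComponents_infty [Infinite ι] [∀ i, Nontrivial (Y i)] :
    ¬ CompactSpace (ComplComponents (∞ : Bouquet e)) := by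
  obtain ⟨h⟩ := Collapse.nonempty_homeomorph_complComponents_infty (F := basePoints e)
  let _ : TopologicalSpace ι := ⊥
  have : DiscreteTopology ι := ⟨rfl⟩
  have hfst : Continuous fun w : ↥((basePoints e : Set (Σ i, Y i))ᶜ) => w.1.1 :=
    (continuous_sigma fun _ => continuous_const).comp continuous_subtype_val
  have hsurj : Function.Surjective fun w : ↥((basePoints e : Set (Σ i, Y i))ᶜ) => w.1.1 := by
    intro i
    obtain ⟨y, hy⟩ := exists_ne (e i)
    exact ⟨⟨⟨i, y⟩, hy⟩, rfl⟩
  intro _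
  exact not_compactSpace_connectedComponents hfst hsurj h.compactSpace

end T1

variable [∀ i, T2Space (Y i)] {e : ∀ i, Y i}

theorem continuous_incl (i : ι) : Continuous (incl e i) :=
  Collapse.continuous_mk.comp continuous_sigmaMk

instance [∀ i, CompactSpace (Y i)] : T2Space (Bouquet e) :=
  have := locallyCompactSpace_sigma (Y := Y)
  inferInstance

instance [Nonempty ι] [∀ i, PathConnectedSpace (Y i)] : PathConnectedSpace (Bouquet e) :=
  Collapse.pathConnectedSpace ⟨⟨Classical.arbitrary ι, e _⟩, rfl⟩ fun w =>
    ⟨⟨w.1, e w.1⟩, rfl, (PathConnectedSpace.joined w.2 (e w.1)).map continuous_sigmaMk⟩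

theorem isPreconnected_proj_preimage_base [∀ i, PreconnectedSpace (Y i)] (i : ι) :
    IsPreconnected (proj e i ⁻¹' {e i}) := by
  refine Collapse.isPreconnected_of_preimage rfl ?_
  rintro ⟨j, y⟩ hy
  by_cases hij : i = j
  · subst hij
    obtain rfl : y = e i := (proj_incl_self i y).symm.trans hy
    exact ⟨{⟨i, e i⟩}, isPreconnected_singleton, rfl, mapsTo_singleton.2 hy, _, rfl, rfl⟩
  · refine ⟨range (Sigma.mk j), isPreconnected_range continuous_sigmaMk, mem_range_self y, ?_,
      _, mem_range_self (e j), rfl⟩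
    rintro _ ⟨z, rfl⟩
    exact proj_incl_of_ne hij z

theorem isConnected_proj_preimage [∀ i, PreconnectedSpace (Y i)] (i : ι) (y : Y i) :
    IsConnected (proj e i ⁻¹' {y}) := by
  refine ⟨⟨incl e i y, proj_incl_self i y⟩, ?_⟩
  by_cases hy : y = e i
  · subst hy
    exact isPreconnected_proj_preimage_base i
  · refine Subsingleton.isPreconnected fun v hv w hw => ?_
    obtain rfl : proj e i v = y := hv
    have hw : proj e i w = proj e i v := hw
    rw [← incl_proj hy, ← hw, incl_proj (hw ▸ hy)]

theorem nonempty_homeomorph_complComponents_incl [∀ i, CompactSpace (Y i)]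
    [∀ i, PreconnectedSpace (Y i)] {i : ι} {y : Y i} (hy : y ≠ e i) :
    Nonempty (ComplComponents (incl e i y) ≃ₜ ComplComponents y) := by
  have hproj : MapsTo (proj e i) {incl e i y}ᶜ {y}ᶜ := by
    rintro x hx rfl
    exact hx (incl_proj hy).symm
  have hincl : MapsTo (incl e i) {y}ᶜ {incl e i y}ᶜ := fun z hz h => hz (incl_injective i h)
  have hquot : IsQuotientMap (hproj.restrict (proj e i) _ _) :=
    .of_inverse ((continuous_incl i).restrict hincl) ((continuous_proj i).restrict hproj)
      fun z => Subtype.ext (proj_incl_self i z.1)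
  refine ⟨hquot.isCoinducing.connectedComponentsHomeomorph fun z => ?_⟩
  have hfiber : Subtype.val '' (hproj.restrict (proj e i) _ _ ⁻¹' {z}) = proj e i ⁻¹' {z.1} := by
    ext x
    constructor
    · rintro ⟨v, hv, rfl⟩
      exact congrArg Subtype.val hv
    · rintro hx
      have hxy : x ≠ incl e i y := by
        rintro rfl
        exact z.2 (hx.symm.trans (proj_incl_self i y))
      exact ⟨⟨x, hxy⟩, Subtype.ext hx, rfl⟩
  have hconn := isConnected_proj_preimage (e := e) i z.1
  rw [← hfiber] at hconn
  exact ⟨hconn.nonempty.of_image, IsInducing.subtypeVal.isPreconnected_image.1 hconn.isPreconnected⟩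

end Bouquet

end Bouquet

theorem weight_collapse_le {X : Type u} [TopologicalSpace X] {κ : Cardinal.{u}} {F : Closeds X}
    [T2Space (Collapse F)] (hκ : ℵ₀ ≤ κ) (hX : weight X ≤ κ) : weight (Collapse F) ≤ κ :=
  weight_onePoint_le hκ ((weight_le_of_isInducing IsInducing.subtypeVal).trans hX)

theorem Fan.weight_le {Z P : Type u} [TopologicalSpace Z] [TopologicalSpace P] [T1Space P] {p : P}
    [T2Space (Fan Z p)] {κ : Cardinal.{u}} (hκ : ℵ₀ ≤ κ) (hZ : weight Z ≤ κ) (hP : weight P ≤ κ) :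
    weight (Fan Z p) ≤ κ :=
  weight_collapse_le hκ (weight_prod_le.trans ((mul_le_mul' hZ hP).trans (mul_eq_self hκ).le))

namespace Bouquet

variable {ι : Type u} {Y : ι → Type u} [∀ i, TopologicalSpace (Y i)] {e : ∀ i, Y i}

theorem weight_le [∀ i, T1Space (Y i)] [T2Space (Bouquet e)] {κ : Cardinal.{u}} (hκ : ℵ₀ ≤ κ)
    (hι : #ι ≤ κ) (hY : ∀ i, weight (Y i) ≤ κ) : weight (Bouquet e) ≤ κ := by
  refine weight_collapse_le hκ (weight_sigma_le.trans ((sum_le_sum _ _ hY).trans ?_))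
  rw [sum_const']
  exact (mul_le_mul' hι le_rfl).trans (mul_eq_self hκ).le

theorem mk_le_weight [∀ i, T2Space (Y i)] [∀ i, CompactSpace (Y i)] [∀ i, Nontrivial (Y i)] :
    #ι ≤ weight (Bouquet e) := by
  choose y hy using fun i => exists_ne (e i)
  refine CountingContinua.mk_le_weight (fun i => incl e i (y i)) (fun i => proj e i ⁻¹' {e i}ᶜ)
    (fun i => isOpen_compl_singleton.preimage (continuous_proj i)) fun i j => ?_
  refine ⟨fun h => by_contra fun hij => h (proj_incl_of_ne hij _), ?_⟩
  rintro rfl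
  rw [mem_preimage, proj_incl_self]
  exact hy i

end Bouquet

/-- The bouquet of the fans `Fan (Z i) p`, attached to each other at the copy of `q` in the petal
of index `z i`. -/
abbrev FanBouquet {ι : Type*} (Z : ι → Type*) [∀ i, TopologicalSpace (Z i)] [∀ i, T2Space (Z i)]
    [∀ i, CompactSpace (Z i)] {P : Type*} [TopologicalSpace P] [T2Space P] [CompactSpace P]
    (p q : P) (z : ∀ i, Z i) : Type _ :=
  Bouquet fun i => Fan.mk p (z i) q

namespace FanBouquet

section Invariant

variable {ι : Type*} {Z : ι → Type*} [∀ i, TopologicalSpace (Z i)] [∀ i, T2Space (Z i)]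
  [∀ i, CompactSpace (Z i)] {P : Type*} [TopologicalSpace P] [T2Space P] [CompactSpace P] {p q : P}
  {z : ∀ i, Z i}

open OnePoint

/-- The `w`-th copy of `P` in the `i`-th fan. -/
noncomputable def petal (p q : P) (z : ∀ i, Z i) (i : ι) (w : Z i) (a : P) : FanBouquet Z p q z :=
  Bouquet.incl _ i (Fan.mk p w a)

theorem continuous_petal (i : ι) (w : Z i) : Continuous (petal p q z i w) :=
  (Bouquet.continuous_incl i).comp (Fan.continuous_mk w)

theorem petal_injective (i : ι) (w : Z i) : Function.Injective (petal p q z i w) :=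
  (Bouquet.incl_injective i).comp (Fan.mk_injective w)

theorem exists_petal_eq [Nonempty ι] (x : FanBouquet Z p q z) : ∃ i w a, petal p q z i w a = x := by
  obtain ⟨i, y, rfl⟩ := Bouquet.exists_incl_eq x
  have : Nonempty (Z i) := ⟨z i⟩
  obtain ⟨w, a, rfl⟩ := Fan.exists_mk_eq y
  exact ⟨i, w, a, rfl⟩

variable [PathConnectedSpace P]

theorem nonempty_homeomorph_complComponents_petal_apex [∀ i, TotallyDisconnectedSpace (Z i)]
    (hp : IsConnected ({p}ᶜ : Set P)) (hpq : p ≠ q) (i : ι) (w : Z i) :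
    Nonempty (ComplComponents (petal p q z i w p) ≃ₜ Z i) := by
  have := fun i => (⟨z i⟩ : Nonempty (Z i))
  have hw : Fan.mk p w p = ∞ := Fan.mk_eq_infty_iff.2 rfl
  have hne : ∞ ≠ Fan.mk p (z i) q := fun h => hpq (Fan.mk_eq_infty_iff.1 h.symm).symm
  rw [petal, hw]
  obtain ⟨h₁⟩ :=
    Bouquet.nonempty_homeomorph_complComponents_incl (e := fun i => Fan.mk p (z i) q) hne
  obtain ⟨h₂⟩ := Fan.nonempty_homeomorph_complComponents_infty (Z := Z i) hp
  exact ⟨h₁.trans h₂⟩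

theorem subsingleton_complComponents_petal {a : P} (ha : IsPreconnected ({a}ᶜ : Set P))
    (hap : a ≠ p) {i : ι} {w : Z i} (h : petal p q z i w a ≠ ∞) :
    Subsingleton (ComplComponents (petal p q z i w a)) := by
  have := fun i => (⟨z i⟩ : Nonempty (Z i))
  have := isPreconnected_iff_preconnectedSpace.1
    (Fan.isPreconnected_compl_singleton_mk (Z := Z i) ha hap w)
  obtain ⟨h⟩ := Bouquet.nonempty_homeomorph_complComponents_incl (e := fun i => Fan.mk p (z i) q)
    fun hw => h (Bouquet.incl_eq_infty_iff.2 hw)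
  exact h.injective.subsingleton

theorem exists_complComponents_homeomorph_iff [Infinite ι] [∀ i, TotallyDisconnectedSpace (Z i)]
    (hP : ∀ a : P, IsConnected ({a}ᶜ : Set P)) (hpq : p ≠ q)
    {T : Type*} [TopologicalSpace T] [CompactSpace T] [Nontrivial T] :
    (∃ x : FanBouquet Z p q z, Nonempty (ComplComponents x ≃ₜ T)) ↔
      ∃ i, Nonempty (Z i ≃ₜ T) := by
  have := fun i => (⟨z i⟩ : Nonempty (Z i))
  have : Nontrivial P := ⟨p, q, hpq⟩
  constructor
  · rintro ⟨x, ⟨h⟩⟩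
    have hx : x ≠ ∞ := by
      rintro rfl
      exact Bouquet.not_compactSpace_complComponents_infty h.symm.compactSpace
    obtain ⟨i, w, a, rfl⟩ := exists_petal_eq x
    obtain rfl : a = p := by
      by_contra hap
      have := subsingleton_complComponents_petal (hP a).isPreconnected hap hx
      exact not_subsingleton T h.symm.injective.subsingleton
    obtain ⟨h'⟩ := nonempty_homeomorph_complComponents_petal_apex (z := z) (hP a) hpq i w
    exact ⟨i, ⟨h'.symm.trans h⟩⟩
  · rintro ⟨i, ⟨h⟩⟩
    obtain ⟨h'⟩ := nonempty_homeomorph_complComponents_petal_apex (z := z) (hP p) hpq i (z i)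
    exact ⟨_, ⟨h'.trans h⟩⟩

end Invariant

section Family

variable {L P : Type*} {Z : L → Type*} [∀ l, TopologicalSpace (Z l)] [∀ l, T2Space (Z l)]
  [∀ l, CompactSpace (Z l)] [∀ l, TotallyDisconnectedSpace (Z l)] [∀ l, Nontrivial (Z l)]
  [TopologicalSpace P] [T2Space P] [CompactSpace P] [PathConnectedSpace P] {p q : P}

theorem range_subset_of_homeomorph (hP : ∀ a : P, IsConnected ({a}ᶜ : Set P)) (hpq : p ≠ q)
    (hZ : ∀ k l, Nonempty (Z k ≃ₜ Z l) → k = l) {ι ι' : Type*} [Infinite ι] [Infinite ι']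
    {φ : ι → L} {ψ : ι' → L} {z : ∀ i, Z (φ i)} {z' : ∀ i, Z (ψ i)}
    (h : FanBouquet (fun i => Z (φ i)) p q z ≃ₜ FanBouquet (fun i => Z (ψ i)) p q z') :
    range φ ⊆ range ψ := by
  rintro _ ⟨i, rfl⟩
  obtain ⟨x, ⟨hx⟩⟩ := (exists_complComponents_homeomorph_iff (z := z) hP hpq).2
    ⟨i, ⟨Homeomorph.refl _⟩⟩
  obtain ⟨h'⟩ := nonempty_homeomorph_complComponents h x
  obtain ⟨k, hk⟩ := (exists_complComponents_homeomorph_iff (z := z') hP hpq).1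
    ⟨h x, ⟨h'.symm.trans hx⟩⟩
  exact ⟨k, hZ _ _ hk⟩

theorem range_eq_of_homeomorph (hP : ∀ a : P, IsConnected ({a}ᶜ : Set P)) (hpq : p ≠ q)
    (hZ : ∀ k l, Nonempty (Z k ≃ₜ Z l) → k = l) {ι ι' : Type*} [Infinite ι] [Infinite ι']
    {φ : ι → L} {ψ : ι' → L} {z : ∀ i, Z (φ i)} {z' : ∀ i, Z (ψ i)}
    (h : FanBouquet (fun i => Z (φ i)) p q z ≃ₜ FanBouquet (fun i => Z (ψ i)) p q z') :
    range φ = range ψ :=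
  (range_subset_of_homeomorph hP hpq hZ h).antisymm (range_subset_of_homeomorph hP hpq hZ h.symm)

end Family

section Cardinality

variable {ι : Type u} {Z : ι → Type u} [∀ i, TopologicalSpace (Z i)] [∀ i, T2Space (Z i)]
  [∀ i, CompactSpace (Z i)] {P : Type u} [TopologicalSpace P] [T2Space P] [CompactSpace P] {p q : P}
  {z : ∀ i, Z i} {κ lam : Cardinal.{u}}

theorem mk_le [Nonempty ι] (hlam : ℵ₀ ≤ lam) (hι : #ι ≤ lam) (hZ : ∀ i, #(Z i) ≤ lam)
    (hP : #P ≤ lam) : #(FanBouquet Z p q z) ≤ lam := by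
  have hsurj : Function.Surjective
      fun v : Σ i, Z i × P => petal p q z v.1 v.2.1 v.2.2 := fun x => by
    obtain ⟨i, w, a, rfl⟩ := exists_petal_eq x
    exact ⟨⟨i, w, a⟩, rfl⟩
  have hZP : ∀ i, #(Z i × P) ≤ lam := fun i => by
    rw [← mul_def]
    exact (mul_le_mul' (hZ i) hP).trans (mul_eq_self hlam).le
  calc #(FanBouquet Z p q z) ≤ sum fun i => #(Z i × P) := mk_sigma _ ▸ mk_le_of_surjective hsurj
    _ ≤ sum fun _ : ι => lam := sum_le_sum _ _ hZP
    _ = #ι * lam := sum_const' _ _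
    _ ≤ lam * lam := mul_le_mul' hι le_rfl
    _ = lam := mul_eq_self hlam

theorem weight_eq [PathConnectedSpace P] (hκ : ℵ₀ ≤ κ) (hι : #ι = κ) (hZ : ∀ i, weight (Z i) ≤ κ)
    (hP : weight P ≤ κ) (hpq : p ≠ q) : weight (FanBouquet Z p q z) = κ := by
  have := fun i => (⟨z i⟩ : Nonempty (Z i))
  have : Nontrivial P := ⟨p, q, hpq⟩
  exact le_antisymm (Bouquet.weight_le hκ hι.le fun i => Fan.weight_le hκ (hZ i) hP)
    (hι ▸ Bouquet.mk_le_weight)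

theorem isPathContinuum [PathConnectedSpace P] (hκ : ℵ₀ ≤ κ) (hι : #ι = κ)
    (hZ : ∀ i, #(Z i) ≤ κ) (hP : weight P ≤ κ) (hpq : p ≠ q) :
    IsPathContinuum κ (max κ #P) (FanBouquet Z p q z) := by
  have := fun i => (⟨z i⟩ : Nonempty (Z i))
  have : Nontrivial P := ⟨p, q, hpq⟩
  have hne : Nonempty ι := mk_ne_zero_iff.1 (hι ▸ (aleph0_pos.trans_le hκ).ne')
  obtain ⟨i⟩ := id hne
  have hinj := petal_injective (p := p) (q := q) (z := z) i (z i)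
  have hcont : IsContinuum (FanBouquet Z p q z) :=
    ⟨inferInstance, inferInstance, inferInstance, hinj.nontrivial⟩
  have hweight : weight (FanBouquet Z p q z) = κ :=
    weight_eq hκ hι (fun i => weight_le_of_mk_le hκ (hZ i)) hP hpq
  refine ⟨hcont, inferInstance, hweight, le_antisymm ?_ (max_le ?_ (mk_le_of_injective hinj))⟩
  · exact mk_le (hκ.trans (le_max_left _ _)) (hι.trans_le (le_max_left _ _))
      (fun i => (hZ i).trans (le_max_left _ _)) (le_max_right _ _)
  · exact hweight ▸ hcont.weight_le_mk

end Cardinality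

theorem balanced {ι J : Type u} {Z : ι → Type u} [∀ i, TopologicalSpace (Z i)] [∀ i, T2Space (Z i)]
    [∀ i, CompactSpace (Z i)] [Nonempty ι] [TopologicalSpace J] [T2Space J] [CompactSpace J]
    {p q : J × J} {z : ∀ i, Z i} (hJ : Balanced J) (hc : #(FanBouquet Z p q z) = #J)
    (hw : weight (FanBouquet Z p q z) = weight J) : Balanced (FanBouquet Z p q z) := by
  refine hJ.of_forall_mem_range hc hw fun x => ?_
  obtain ⟨i, w, ⟨a, b⟩, rfl⟩ := exists_petal_eq x
  have hinj : Function.Injective fun a => petal p q z i w (a, b) :=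
    (petal_injective i w).comp (Prod.mk_left_injective b)
  have hcont : Continuous fun a => petal p q z i w (a, b) :=
    (continuous_petal i w).comp (by fun_prop)
  exact ⟨_, (hcont.isClosedEmbedding hinj).isEmbedding, a, rfl⟩

end FanBouquet

theorem exists_nonhomeomorphic_continua {κ : Cardinal.{u}} (hκ : ℵ₀ ≤ κ) {J : Type u}
    [TopologicalSpace J] (hJ : IsContinuum J) (hpath : PathConnectedSpace J) (hw : weight J ≤ κ) :
    ∃ (I : Type u) (X : I → Type u) (_ : ∀ i, TopologicalSpace (X i)),
      #I = 2 ^ κ ∧ MutuallyNonHomeomorphic X ∧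
      (∀ i, IsPathContinuum κ (max κ #J) (X i)) ∧
      (Balanced J → weight J = κ → ∀ i, Balanced (X i)) := by
  obtain ⟨_, _, _, _⟩ := id hJ
  have := hJ.infinite
  let K := κ.out
  have hK : #K = κ := mk_out κ
  have : Infinite K := infinite_iff.2 (hK ▸ hκ)
  have hKK : #(K ⊕ K) = κ := by rw [← add_def, hK, add_eq_self hκ]
  obtain ⟨Z, _, hZ, hZne⟩ := exists_nonhomeomorphic_totallyDisconnected hκ hKK.le
  choose _ _ _ _ hZκ using hZ
  let φ (B : Set K) : K ⊕ B → K ⊕ K := Sum.map id Subtype.val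
  have hφ : Function.Injective fun B => range (φ B) := fun B B' h => by
    ext k
    simpa [φ] using Set.ext_iff.1 h (Sum.inr k)
  have hι (B : Set K) : #(K ⊕ B) = κ := by
    rw [← add_def, hK, add_eq_left hκ ((mk_set_le B).trans hK.le)]
  obtain ⟨p, q, hpq⟩ := exists_pair_ne (J × J)
  have hJJ : weight (J × J) ≤ κ :=
    weight_prod_le.trans ((mul_le_mul' hw hw).trans (mul_eq_self hκ).le)
  let X (B : Set K) := FanBouquet (fun i => Z (φ B i)) p q fun i => Classical.arbitrary (Z (φ B i))
  have hX (B : Set K) : IsPathContinuum κ (max κ #J) (X B) := by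
    have hP : #J = #(J × J) := by rw [← mul_def, mul_eq_self (aleph0_le_mk J)]
    rw [hP]
    exact FanBouquet.isPathContinuum hκ (hι B) (fun i => hZκ _) hJJ hpq
  refine ⟨Set K, X, fun _ => inferInstance, by rw [mk_set, hK], fun B B' hne => ⟨fun h => hne ?_⟩,
    hX, fun hbal hwJ B => FanBouquet.balanced hbal ?_ ?_⟩
  · exact hφ (FanBouquet.range_eq_of_homeomorph isConnected_compl_singleton_prod hpq hZne h)
  · rw [(hX B).size_eq, max_eq_right (hwJ ▸ hJ.weight_le_mk)]
  · rw [(hX B).weight_eq, hwJ]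

section Cube

variable {K : Type u}

theorem weight_cube_le {κ : Cardinal.{u}} (hκ : ℵ₀ ≤ κ) (hK : #K ≤ κ) :
    weight (K → unitInterval) ≤ κ := by
  have hI : weight (ULift.{u} unitInterval) ≤ κ := by
    obtain ⟨B, hBc, -, hB⟩ := exists_countable_basis (ULift.{u} unitInterval)
    exact (weight_le_of_isTopologicalBasis hB).trans ((mk_le_aleph0_iff.2 hBc.to_subtype).trans hκ)
  rw [weight_eq_of_homeomorph (Homeomorph.piCongrRight fun _ : K => Homeomorph.ulift.symm)]
  exact weight_pi_le hκ hK fun _ => hI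

theorem mk_le_weight_cube (K : Type u) : #K ≤ weight (K → unitInterval) := by
  classical
  refine mk_le_weight (fun k => Pi.single k 1) (fun k => (fun f => f k) ⁻¹' {0}ᶜ)
    (fun k => isOpen_compl_singleton.preimage (continuous_apply k)) fun k l => ?_
  refine ⟨fun h => by_contra fun hkl => h (Pi.single_eq_of_ne hkl _), ?_⟩
  rintro rfl
  simp

theorem weight_cube [Infinite K] : weight (K → unitInterval) = #K :=
  le_antisymm (weight_cube_le (aleph0_le_mk K) le_rfl) (mk_le_weight_cube K)

theorem mk_cube [Infinite K] : #(K → unitInterval) = 2 ^ #K := by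
  have hI : #unitInterval = continuum := mk_Icc_real zero_lt_one
  rw [mk_pi, prod_const, hI, lift_continuum, lift_uzero, continuum, ← power_mul,
    aleph0_mul_eq (aleph0_le_mk K)]

theorem pathConnectedSpace_cube : PathConnectedSpace (K → unitInterval) := by
  have : PathConnectedSpace unitInterval := isPathConnected_iff_pathConnectedSpace.1
    ((convex_Icc (0 : ℝ) 1).isPathConnected ⟨0, by simp⟩)
  infer_instance

theorem isContinuum_cube [Nonempty K] : IsContinuum (K → unitInterval) :=
  ⟨inferInstance, inferInstance, inferInstance, inferInstance⟩

theorem balanced_cube [Infinite K] : Balanced (K → unitInterval) := by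
  classical
  refine Balanced.of_forall_range_subset fun U hU ⟨f, hf⟩ => ?_
  obtain ⟨F, u, hu, hFU⟩ := isOpen_pi_iff.1 hU f hf
  obtain ⟨e⟩ : Nonempty ({k // k ∉ F} ≃ K) := Cardinal.eq.1 (mk_compl_finset_of_infinite F)
  let φ : (K → unitInterval) → K → unitInterval :=
    fun g k => if hk : k ∈ F then f k else g (e ⟨k, hk⟩)
  have hφ : Continuous φ := by
    refine continuous_pi fun k => ?_
    by_cases hk : k ∈ F
    · simpa only [φ, hk, dif_pos] using continuous_const
    · simpa only [φ, hk, dif_neg, not_false_iff] using continuous_apply _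
  have hinj : Function.Injective φ := by
    intro g g' h
    funext k
    have hk : ¬ (e.symm k).1 ∈ F := (e.symm k).2
    simpa only [φ, hk, dif_neg, not_false_iff, Subtype.coe_eta, e.apply_symm_apply] using
      congrFun h (e.symm k).1
  refine ⟨φ, (hφ.isClosedEmbedding hinj).isEmbedding, ?_⟩
  rintro _ ⟨g, rfl⟩
  refine hFU fun k hk => ?_
  simpa only [φ, Finset.mem_coe.1 hk, dif_pos] using (hu k hk).2

end Cube

section Closeds

variable {X : Type u} [TopologicalSpace X]

theorem mk_opens_le : #(Opens X) ≤ 2 ^ weight X := by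
  obtain ⟨B, hB, hBc⟩ := exists_isTopologicalBasis_mk_eq_weight X
  rw [← hBc, ← mk_powerset]
  refine mk_le_of_injective
    (f := fun U : Opens X => (⟨{s ∈ B | s ⊆ U}, fun _ h => h.1⟩ : 𝒫 B)) fun U V h => ?_
  refine Opens.ext ?_
  rw [hB.open_eq_sUnion' U.isOpen, hB.open_eq_sUnion' V.isOpen]
  exact congrArg (fun S : 𝒫 B => Set.sUnion S.1) h

theorem mk_closeds_le : #(Closeds X) ≤ 2 ^ weight X :=
  (mk_congr (Opens.complOrderIso X).toEquiv).symm.trans_le mk_opens_le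

theorem exists_continuous_eqOn_zero_one [NormalSpace X] {A B : Set X} (hA : IsClosed A)
    (hB : IsClosed B) (h : Disjoint A B) :
    ∃ f : X → unitInterval, Continuous f ∧ EqOn f 0 A ∧ EqOn f 1 B := by
  obtain ⟨f, h0, h1, hf⟩ := exists_continuous_zero_one_of_isClosed hA hB h
  exact ⟨fun x => ⟨f x, hf x⟩, f.continuous.subtype_mk _, fun x hx => Subtype.ext (h0 hx),
    fun x hx => Subtype.ext (h1 hx)⟩

theorem exists_isClosedEmbedding_cube [CompactSpace X] [T2Space X] {K : Type u} [Infinite K]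
    (hw : weight X ≤ #K) : ∃ f : X → K → unitInterval, IsClosedEmbedding f := by
  obtain ⟨B, hB, hBc⟩ := exists_isTopologicalBasis_mk_eq_weight X
  -- One Urysohn function for each pair of basic sets with disjoint closures.
  let D := {b : B × B // Disjoint (closure b.1.1) (closure b.2.1)}
  choose f hf hf0 hf1 using fun b : D =>
    exists_continuous_eqOn_zero_one isClosed_closure isClosed_closure b.2
  obtain ⟨j⟩ : #D ≤ #K := by
    refine (mk_subtype_le _).trans ?_
    rw [← mul_def, hBc]
    exact (mul_le_mul' hw hw).trans (mul_eq_self (aleph0_le_mk K)).le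
  let g : X → K → unitInterval := fun x => Function.extend j (fun b => f b x) 0
  have hgj : ∀ x b, g x (j b) = f b x := fun x b => j.injective.extend_apply _ _ _
  have hg : Continuous g := by
    refine continuous_pi fun k => ?_
    by_cases hk : ∃ b, j b = k
    · obtain ⟨b, rfl⟩ := hk
      simpa only [hgj] using hf b
    · simpa only [g, Function.extend_apply' _ _ _ hk] using continuous_const
  refine ⟨g, hg.isClosedEmbedding fun x y hxy => ?_⟩
  by_contra hne
  obtain ⟨U, hxU, hU, V, hyV, hV, hd⟩ := exists_open_nhds_disjoint_closure hne
  obtain ⟨U', hU', hxU', hUU'⟩ := hB.exists_subset_of_mem_open hxU hU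
  obtain ⟨V', hV', hyV', hVV'⟩ := hB.exists_subset_of_mem_open hyV hV
  let b : D := ⟨(⟨U', hU'⟩, ⟨V', hV'⟩), hd.mono (closure_mono hUU') (closure_mono hVV')⟩
  have h : f b x = f b y := by rw [← hgj, hxy, hgj]
  rw [hf0 b (subset_closure hxU'), hf1 b (subset_closure hyV')] at h
  exact zero_ne_one h

end Closeds

section Representatives

variable {X Y : Type u} [TopologicalSpace X] [TopologicalSpace Y]

theorem IsPathContinuum.of_homeomorph {κ lam : Cardinal.{u}} (h : X ≃ₜ Y)
    (hX : IsPathContinuum κ lam X) : IsPathContinuum κ lam Y := by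
  obtain ⟨⟨_, _, _, _⟩, _, hw, hs⟩ := hX
  have hpath : PathConnectedSpace Y := h.surjective.pathConnectedSpace h.continuous
  exact ⟨⟨h.compactSpace, h.t2Space, inferInstance, h.injective.nontrivial⟩, hpath,
    (weight_eq_of_homeomorph h).symm.trans hw, (mk_congr h.symm.toEquiv).trans hs⟩

theorem Balanced.of_homeomorph (h : X ≃ₜ Y) (hX : Balanced X) : Balanced Y :=
  hX.of_forall_mem_range (mk_congr h.symm.toEquiv) (weight_eq_of_homeomorph h.symm)
    fun y => ⟨h, h.isEmbedding, h.symm y, h.apply_symm_apply y⟩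

theorem exists_transversal {S : Type u} (C : S → Type u) [∀ s, TopologicalSpace (C s)] :
    ∃ (I : Type u) (r : I → S), #I ≤ #S ∧ MutuallyNonHomeomorphic (fun i => C (r i)) ∧
      ∀ s, ∃ i, Nonempty (C s ≃ₜ C (r i)) := by
  let r : Setoid S :=
    { r := fun s t => Nonempty (C s ≃ₜ C t)
      iseqv := ⟨fun _ => ⟨.refl _⟩, fun ⟨h⟩ => ⟨h.symm⟩, fun ⟨h⟩ ⟨h'⟩ => ⟨h.trans h'⟩⟩ }
  refine ⟨Quotient r, Quotient.out, mk_quotient_le, fun i k hik => ⟨fun h => hik ?_⟩,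
    fun s => ⟨⟦s⟧, Quotient.exact (Quotient.out_eq ⟦s⟧).symm⟩⟩
  exact Quotient.out_equiv_out.1 ⟨h⟩

theorem mk_le_of_mutuallyNonHomeomorphic {I I' : Type u} {X : I → Type u} {X' : I' → Type u}
    [∀ i, TopologicalSpace (X i)] [∀ i, TopologicalSpace (X' i)] (hX : MutuallyNonHomeomorphic X)
    (h : ∀ i, ∃ k, Nonempty (X i ≃ₜ X' k)) : #I ≤ #I' := by
  choose k hk using h
  refine mk_le_of_injective (f := k) fun i j hij => by_contra fun hne => ?_
  obtain ⟨hi⟩ := hk i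
  obtain ⟨hj⟩ := hij ▸ hk j
  exact (hX i j hne).false (hi.trans hj.symm)

theorem exists_representatives {κ : Cardinal.{u}} (hκ : ℵ₀ ≤ κ)
    (Q : ∀ (X : Type u) [TopologicalSpace X], Prop)
    (hQ : ∀ (X : Type u) [TopologicalSpace X], Q X → CompactSpace X ∧ T2Space X ∧ weight X ≤ κ)
    (hQh : ∀ (X Y : Type u) [TopologicalSpace X] [TopologicalSpace Y], (X ≃ₜ Y) → Q X → Q Y) :
    ∃ (I : Type u) (X : I → Type u) (_ : ∀ i, TopologicalSpace (X i)),
      #I ≤ 2 ^ κ ∧ MutuallyNonHomeomorphic X ∧ (∀ i, Q (X i)) ∧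
      ∀ (Y : Type u) [TopologicalSpace Y], Q Y → ∃ i, Nonempty (Y ≃ₜ X i) := by
  have hK : #κ.out = κ := mk_out κ
  have : Infinite κ.out := infinite_iff.2 (hκ.trans_eq hK.symm)
  let S := {C : Closeds (κ.out → unitInterval) // Q C}
  have hS : #S ≤ 2 ^ κ := by
    refine (mk_subtype_le _).trans (mk_closeds_le.trans ?_)
    rw [weight_cube, hK]
  obtain ⟨I, r, hI, hr, hcomplete⟩ := exists_transversal fun C : S => C.1
  refine ⟨I, fun i => (r i).1, inferInstance, hI.trans hS, hr, fun i => (r i).2, fun Y _ hY => ?_⟩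
  obtain ⟨_, _, hw⟩ := hQ Y hY
  obtain ⟨f, hf⟩ := exists_isClosedEmbedding_cube (hw.trans hK.ge)
  have h : Y ≃ₜ range f := hf.isEmbedding.toHomeomorph
  obtain ⟨i, ⟨hi⟩⟩ := hcomplete ⟨⟨range f, hf.isClosed_range⟩, hQh Y _ h hY⟩
  exact ⟨i, ⟨h.trans hi⟩⟩

end Representatives

theorem exists_nonhomeomorphic_balanced_continua {κ : Cardinal.{u}} (hκ : ℵ₀ ≤ κ) :
    ∃ (I : Type u) (X : I → Type u) (_ : ∀ i, TopologicalSpace (X i)),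
      #I = 2 ^ κ ∧ MutuallyNonHomeomorphic X ∧
      ∀ i, IsPathContinuum κ (2 ^ κ) (X i) ∧ Balanced (X i) := by
  have hK : #κ.out = κ := mk_out κ
  have : Infinite κ.out := infinite_iff.2 (hκ.trans_eq hK.symm)
  have hw : weight (κ.out → unitInterval) = κ := weight_cube.trans hK
  obtain ⟨I, X, _, hI, hX, hcont, hbal⟩ :=
    exists_nonhomeomorphic_continua hκ isContinuum_cube pathConnectedSpace_cube hw.le
  rw [mk_cube, hK, max_eq_right (cantor κ).le] at hcont
  exact ⟨I, X, _, hI, hX, fun i => ⟨hcont i, hbal balanced_cube hw i⟩⟩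

end CountingContinua

theorem theorem18 (κ : Cardinal.{u}) (hκ : ℵ₀ ≤ κ) :
    (∀ (J : Type u) [TopologicalSpace J],
      CountingContinua.IsContinuum J → PathConnectedSpace J → CountingContinua.weight J ≤ κ →
      ∃ (I : Type u) (X : I → Type u) (_ : ∀ i, TopologicalSpace (X i)),
        #I = 2 ^ κ ∧
        CountingContinua.MutuallyNonHomeomorphic X ∧
        (∀ i, CountingContinua.IsPathContinuum κ (max κ #J) (X i)) ∧
        (CountingContinua.Balanced J → CountingContinua.weight J = κ →
          ∀ i, CountingContinua.Balanced (X i))) ∧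
    -- a complete system of representatives, of cardinality `2 ^ κ`, up to homeomorphism
    (∃ (I : Type u) (X : I → Type u) (_ : ∀ i, TopologicalSpace (X i)),
      #I = 2 ^ κ ∧
      CountingContinua.MutuallyNonHomeomorphic X ∧
      (∀ i, CountingContinua.IsPathContinuum κ (2 ^ κ) (X i) ∧ CountingContinua.Balanced (X i)) ∧
      ∀ (Y : Type u) [TopologicalSpace Y],
        CountingContinua.IsPathContinuum κ (2 ^ κ) Y → CountingContinua.Balanced Y →
        ∃ i, Nonempty (Y ≃ₜ X i)) := by
  open CountingContinua in
  refine ⟨fun J _ => exists_nonhomeomorphic_continua hκ, ?_⟩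
  obtain ⟨I', X', _, hI', hX', hQ'⟩ := exists_nonhomeomorphic_balanced_continua hκ
  obtain ⟨I, X, _, hI, hX, hQ, hcomplete⟩ := exists_representatives hκ
    (fun X _ => IsPathContinuum κ (2 ^ κ) X ∧ Balanced X)
    (fun X _ h => ⟨h.1.continuum.compact, h.1.continuum.hausdorff, h.1.weight_eq.le⟩)
    (fun X Y _ _ e h => ⟨h.1.of_homeomorph e, h.2.of_homeomorph e⟩)
  have hI'I : #I' ≤ #I := mk_le_of_mutuallyNonHomeomorphic hX' fun i => hcomplete (X' i) (hQ' i)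
  exact ⟨I, X, _, hI.antisymm (hI' ▸ hI'I), hX, hQ, fun Y _ hY hbal => hcomplete Y ⟨hY, hbal⟩⟩
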